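/- Consider a homogeneous-goods market: a finite set $B$ of buyers, a finite set $S$ of $m$ sellers with one good each, a bipartite graph $G$ of direct links, and values $w_i\ge 0$, buyer $i$ valuing every seller's good at $w_i$ and wanting at most one good. A competitive equilibrium of a network is a pair (prices $p\ge 0$, allocation along links giving each buyer at most one good and selling each good at most once) in which each buyer's utility is nonnegative and at least $w_i-p_j$ for every seller $j$ linked to her, and unsold goods have price $0$; $p$ is then called competitive. For $P\subseteq S$ let $G(P)$ be $G$ with every seller of $P$ linked to all buyers, and let $p(P)$ be the coordinatewise maximum of the competitive price vectors of $G(P)$. For a fee $\alpha\in[0,1]$, $P$ is a pure Platform Equilibrium at $\alpha$ if $(1-\alpha)p_j(P)\ge p_j(P\setminus\{j\})$ for all $j\in P$ and $p_j(P)\ge(1-\alpha)p_j(P\cup\{j\})$ for all $j\notin P$. Put $p_j^{\mathrm{off}}(P)=p_j(P\setminus\{j\})$ and $\phi_j^P(\alpha)=(1-\alpha)\,p_j(P\cup\{j\})-p_j^{\mathrm{off}}(P)$. Algorithm 1 at fee $\alpha$ starts with $P=\emptyset$. While $P\ne S$, it picks a candidate, i.e. a seller $\hat\jmath$ with the smallest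 $p^{\mathrm{off}}_j(P)$ among the maximizers of $\phi_j^P(\alpha)$ over $j\in S\setminus P$ (remaining ties broken arbitrarily); if $\phi_{\hat\jmath}^P(\alpha)\ge 0$ it adds $\hat\jmath$ to $P$ and repeats, and otherwise it stops. It outputs the last $P$. A sweep starts with $\alpha=1$, $P=\emptyset$, and repeatedly does one of the following: it lowers the fee continuously from $\alpha$ to some $\alpha'\in[0,\alpha]$, allowed if $\phi_j^P(\beta)<0$ for all $j\notin P$ and all $\beta\in(\alpha',\alpha]$; or it carries out one iteration of Algorithm 1 at the current fee, adding one candidate of nonnegative gain. **Theorem.** In every homogeneous-goods market the maximum competitive prices $p(P)$ exist for all $P\subseteq S$ and are themselves competitive, and: 1. For every $m_p=1,\dots,m$ there are $\alpha\in[0,1]$ and $P\subseteq S$ with $|P|=m_p$ such that $P$ is a pure Platform Equilibrium at $\alpha$, and such that some sweep reaches $(\alpha,P)$. 2. Whenever a sweep reaches $(\alpha,P)$, the set $P$ is a pure Platform Equilibrium at $\alpha$, $P$ occurs in a run of Algorithm 1 at the fixed fee $\alpha$, and $\phi_j^P(\alpha)\le 0$ for all $j\notin P$. 3. If a sweep reaches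 $(\alpha,P)$ with $P\neq S$, then the fee can be lowered to some $\alpha'\in[0,\alpha]$ such that $(\alpha',P)$ is reached by a sweep, the gain $\phi_{\hat\jmath}^P(\alpha')$ of some candidate $\hat\jmath$ is exactly $0$, and a sweep reaches $(\alpha',P\cup\{\hat\jmath\})$. Thus equilibria of all sizes are found by lowering $\alpha$ from $1$ to $0$ and adding one seller at a time. 4. Every output of Algorithm 1 at any fixed fee $\alpha\in[0,1]$ is reached, at that fee, by a sweep. -/

import Mathlib

noncomputable section

namespace PlatformMarket

variable {Buyer Seller : Type*}

/-- Quasi-linear utility of buyer `i` when she receives the good `x` (`none` means no good). -/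
def buyerUtility (v : Buyer → Seller → ℝ) (p : Seller → ℝ) (i : Buyer) : Option Seller → ℝ
  | none => 0
  | some j => v i j - p j

/-- Competitive (Walrasian) equilibrium `(p, a)` of the unit-demand buyer-seller network `g` with
values `v`. The allocation is recorded by the good `a i` that buyer `i` receives, so that every
buyer gets at most one good by construction. -/
structure IsCompetitiveEquilibrium (v : Buyer → Seller → ℝ) (g : Buyer → Seller → Prop)
    (p : Seller → ℝ) (a : Buyer → Option Seller) : Prop where
  price_nonneg : ∀ j, 0 ≤ p j
  respects_links : ∀ i j, a i = some j → g i j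
  sold_at_most_once : ∀ i i' j, a i = some j → a i' = some j → i = i'
  most_preferred : ∀ i j, g i j → v i j - p j ≤ buyerUtility v p i (a i)
  utility_nonneg : ∀ i, 0 ≤ buyerUtility v p i (a i)
  unsold_price_zero : ∀ j, (∀ i, a i ≠ some j) → p j = 0

/-- Competitive price vectors: those that belong to some competitive equilibrium. -/
def IsCompetitivePrice (v : Buyer → Seller → ℝ) (g : Buyer → Seller → Prop)
    (p : Seller → ℝ) : Prop :=
  ∃ a, IsCompetitiveEquilibrium v g p a

/-- The maximum competitive prices (coordinatewise supremum of the competitive prices). -/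
def maxPrice (v : Buyer → Seller → ℝ) (g : Buyer → Seller → Prop) (j : Seller) : ℝ :=
  sSup {x | ∃ p, IsCompetitivePrice v g p ∧ p j = x}

/-- The network `G(P)`: sellers in `P` are linked to all buyers, other links are unchanged. -/
def platformGraph (g : Buyer → Seller → Prop) (P : Finset Seller) : Buyer → Seller → Prop :=
  fun i j => j ∈ P ∨ g i j

/-- The prices `p(P)` at which the market clears when the set `P` of sellers is on the platform. -/
def platformPrice (v : Buyer → Seller → ℝ) (g : Buyer → Seller → Prop) (P : Finset Seller)
    (j : Seller) : ℝ :=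
  maxPrice v (platformGraph g P) j

/-- Values in a homogeneous-goods market: buyer `i` values every good at `w i`. -/
def homogeneousValue (w : Buyer → ℝ) : Buyer → Seller → ℝ := fun i _ => w i

variable [DecidableEq Seller]

/-- `P` is a pure Platform Equilibrium at the transaction fee `α`. -/
def IsPurePlatformEquilibrium (v : Buyer → Seller → ℝ) (g : Buyer → Seller → Prop) (α : ℝ)
    (P : Finset Seller) : Prop :=
  (∀ j ∈ P, platformPrice v g (P.erase j) j ≤ (1 - α) * platformPrice v g P j) ∧
    ∀ j ∉ P, (1 - α) * platformPrice v g (insert j P) j ≤ platformPrice v g P j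

/-- `j`'s price when `j` joins and the sellers in `P \ {j}` are on the platform. -/
def onPrice (v : Buyer → Seller → ℝ) (g : Buyer → Seller → Prop) (P : Finset Seller)
    (j : Seller) : ℝ :=
  platformPrice v g (insert j P) j

/-- `j`'s price when `j` stays off and the sellers in `P \ {j}` are on the platform. -/
def offPrice (v : Buyer → Seller → ℝ) (g : Buyer → Seller → Prop) (P : Finset Seller)
    (j : Seller) : ℝ :=
  platformPrice v g (P.erase j) j

/-- The gain `φ_j^P` of seller `j` from joining the platform at the fee `α`. -/
def gain (v : Buyer → Seller → ℝ) (g : Buyer → Seller → Prop) (α : ℝ) (P : Finset Seller)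
    (j : Seller) : ℝ :=
  (1 - α) * onPrice v g P j - offPrice v g P j

/-- `j` is a candidate of the algorithm at `P`: it maximizes the gain among the sellers outside
`P`, and has the lowest off-platform price among these maximizers. -/
def IsCandidate (v : Buyer → Seller → ℝ) (g : Buyer → Seller → Prop) (α : ℝ)
    (P : Finset Seller) (j : Seller) : Prop :=
  j ∉ P ∧ (∀ j' ∉ P, gain v g α P j' ≤ gain v g α P j) ∧
    ∀ j' ∉ P, gain v g α P j' = gain v g α P j → offPrice v g P j ≤ offPrice v g P j'

/-- One iteration of the algorithm at the fee `α`: a candidate whose gain is nonnegative is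
added. (Ties between candidates are broken arbitrarily.) -/
def AlgStep (v : Buyer → Seller → ℝ) (g : Buyer → Seller → Prop) (α : ℝ)
    (P Q : Finset Seller) : Prop :=
  ∃ j, IsCandidate v g α P j ∧ 0 ≤ gain v g α P j ∧ Q = insert j P

/-- `P` occurs during some run, from the empty set, of the algorithm at the fixed fee `α`. -/
def AlgVisits (v : Buyer → Seller → ℝ) (g : Buyer → Seller → Prop) (α : ℝ)
    (P : Finset Seller) : Prop :=
  Relation.ReflTransGen (AlgStep v g α) ∅ P

/-- `P` is the output of some run of the algorithm at the fixed fee `α`. -/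
def AlgOutputs (v : Buyer → Seller → ℝ) (g : Buyer → Seller → Prop) (α : ℝ)
    (P : Finset Seller) : Prop :=
  AlgVisits v g α P ∧ ¬ ∃ Q, AlgStep v g α P Q

/-- `SweepReaches v g α P`: some sweep, which starts with fee `1` and no seller on the platform,
reaches the fee `α` with the set `P` on the platform. The fee may be lowered from `α` to `α'` if
every seller outside `P` has a negative gain at each fee strictly above `α'` that is passed; an
iteration of the algorithm may be carried out at the current fee. -/
inductive SweepReaches (v : Buyer → Seller → ℝ) (g : Buyer → Seller → Prop) :
    ℝ → Finset Seller → Prop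
  | start : SweepReaches v g 1 ∅
  | lower {α α' : ℝ} {P : Finset Seller} : SweepReaches v g α P → 0 ≤ α' → α' ≤ α →
      (∀ β, α' < β → β ≤ α → ∀ j ∉ P, gain v g β P j < 0) → SweepReaches v g α' P
  | add {α : ℝ} {P Q : Finset Seller} : SweepReaches v g α P → AlgStep v g α P Q →
      SweepReaches v g α Q

end PlatformMarket

end

/-!
The maximum competitive price of a seller is her marginal weight, the increase of the largest total
value of a matching when she joins. An exchange along alternating paths shows that marginal
weights fall as sellers join. If all goods are worth the same to a buyer, then the value of a
matching depends only on the buyers it serves, and the exchange gives more: a seller with a smaller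
marginal weight than `x` can join without changing the marginal weight of `x`.

It follows for sellers `j` and `k` off the platform that `j` gets by joining at most the larger of
her current price and the price that `k` would get by joining. Hence, at every fee, the sellers with
the lowest current price gain most from joining, and the candidates of the algorithm are exactly
these sellers. So the algorithm and the sweep add sellers in the same order, and the fee decides
only when they halt. Since gains fall continuously as the fee rises, a sweep can lower the fee
until the gain of a candidate is zero. The sellers on the platform stay there when the candidate
joins, because each of them would get no more than the price of the candidate if she left.
-/

namespace PlatformMarket

section Matching

variable {Buyer τ : Type*} {h : Buyer → τ → Prop} {T T' T₁ T₂ : Finset τ}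
  {a b : Buyer → Option τ} {D : Set τ} {i : Buyer} {k s x y : τ}

/-- A matching of buyers along the network `h` to distinct sellers of `T`. As in
`IsCompetitiveEquilibrium`, `a i` is the seller matched to the buyer `i`. -/
structure IsMatching (h : Buyer → τ → Prop) (T : Finset τ) (a : Buyer → Option τ) : Prop where
  mem : ∀ {i s}, a i = some s → s ∈ T
  link : ∀ {i s}, a i = some s → h i s
  inj : ∀ {i i' s}, a i = some s → a i' = some s → i = i'

theorem isMatching_none : IsMatching h T fun _ => none := by
  constructor <;> simp

theorem IsMatching.of_forall_mem (ha : IsMatching h T a) (hT : ∀ {i s}, a i = some s → s ∈ T') :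
    IsMatching h T' a :=
  ⟨hT, ha.link, ha.inj⟩

theorem IsMatching.map {σ : Type*} {h' : Buyer → σ → Prop} {T' : Finset σ} {e : τ → σ}
    (ha : IsMatching h T a) (he : Set.InjOn e T) (hT : ∀ s ∈ T, e s ∈ T')
    (hl : ∀ i, ∀ s ∈ T, h i s → h' i (e s)) : IsMatching h' T' fun i => (a i).map e := by
  refine ⟨fun hs => ?_, fun hs => ?_, fun hs hs' => ?_⟩ <;>
    obtain ⟨t, ht, rfl⟩ := Option.map_eq_some_iff.1 hs
  · exact hT t (ha.mem ht)
  · exact hl _ t (ha.mem ht) (ha.link ht)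
  · obtain ⟨t', ht', hte⟩ := Option.map_eq_some_iff.1 hs'
    exact ha.inj ht (he (ha.mem ht') (ha.mem ht) hte ▸ ht')

theorem IsMatching.update_none [DecidableEq Buyer] [DecidableEq τ] (ha : IsMatching h T a)
    (hi : a i = some s) : IsMatching h (T.erase s) (Function.update a i none) := by
  have hne : ∀ {i' t}, Function.update a i none i' = some t → i' ≠ i ∧ a i' = some t := by
    intro i' t ht
    by_cases hi' : i' = i <;> simp_all
  refine ⟨fun ht => Finset.mem_erase.2 ⟨?_, ha.mem (hne ht).2⟩, fun ht => ha.link (hne ht).2,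
    fun ht ht' => ha.inj (hne ht).2 (hne ht').2⟩
  rintro rfl
  exact (hne ht).1 (ha.inj (hne ht).2 hi)

theorem IsMatching.update_some [DecidableEq Buyer] [DecidableEq τ]
    (ha : IsMatching h (T.erase k) a) (hk : k ∈ T) (hik : h i k) :
    IsMatching h T (Function.update a i (some k)) := by
  have hne : ∀ {i'}, a i' ≠ some k := fun e => Finset.notMem_erase k T (ha.mem e)
  have hcases : ∀ {i' t}, Function.update a i (some k) i' = some t →
      i' = i ∧ t = k ∨ a i' = some t ∧ t ≠ k := by
    intro i' t ht
    by_cases hi' : i' = i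
    · subst hi'
      simp_all
    · rw [Function.update_of_ne hi'] at ht
      exact .inr ⟨ht, fun e => hne (e ▸ ht)⟩
  refine ⟨fun ht => ?_, fun ht => ?_, fun ht ht' => ?_⟩
  · rcases hcases ht with ⟨-, rfl⟩ | ⟨ht, -⟩
    exacts [hk, Finset.mem_of_mem_erase (ha.mem ht)]
  · rcases hcases ht with ⟨rfl, rfl⟩ | ⟨ht, -⟩
    exacts [hik, ha.link ht]
  · rcases hcases ht with ⟨rfl, rfl⟩ | ⟨ht, hk⟩ <;> rcases hcases ht' with ⟨rfl, hk'⟩ | ⟨ht', hk'⟩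
    exacts [rfl, absurd rfl hk', absurd hk' hk, ha.inj ht ht']

/-- A set `D` of sellers is closed under exchange between the allocations `a` and `b` if `a` and
`b` give each buyer served in both either two sellers of `D` or none, so that `a` and `b` can be
swapped on `D`. -/
def IsExchangeClosed (a b : Buyer → Option τ) (D : Set τ) : Prop :=
  ∀ ⦃i s t⦄, a i = some s → b i = some t → (s ∈ D ↔ t ∈ D)

theorem IsExchangeClosed.symm (hD : IsExchangeClosed a b D) : IsExchangeClosed b a D :=
  fun _ _ _ hb ha => (hD ha hb).symm

open Classical in
/-- The allocation that follows `a` for the buyers whom `a` or `b` matches to `D` and follows `b`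
for the others. -/
noncomputable def exchangeOn (D : Set τ) (a b : Buyer → Option τ) : Buyer → Option τ := fun i =>
  if ∃ s ∈ D, a i = some s ∨ b i = some s then a i else b i

theorem exchangeOn_eq_some_iff (hD : IsExchangeClosed a b D) :
    exchangeOn D a b i = some s ↔ s ∈ D ∧ a i = some s ∨ s ∉ D ∧ b i = some s := by
  unfold exchangeOn
  split_ifs with hi
  · have := @hD i
    grind
  · push Not at hi
    grind

theorem IsMatching.exchange (ha : IsMatching h T₁ a) (hb : IsMatching h T₂ b)
    (hD : IsExchangeClosed a b D) (haT : ∀ s ∈ T₁, s ∈ D → s ∈ T')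
    (hbT : ∀ s ∈ T₂, s ∉ D → s ∈ T') : IsMatching h T' (exchangeOn D a b) := by
  refine ⟨fun hs => ?_, fun hs => ?_, fun hs hs' => ?_⟩ <;> rw [exchangeOn_eq_some_iff hD] at hs
  · rcases hs with ⟨hsD, hs⟩ | ⟨hsD, hs⟩
    exacts [haT _ (ha.mem hs) hsD, hbT _ (hb.mem hs) hsD]
  · rcases hs with ⟨-, hs⟩ | ⟨-, hs⟩
    exacts [ha.link hs, hb.link hs]
  · rw [exchangeOn_eq_some_iff hD] at hs'
    rcases hs with ⟨hsD, hs⟩ | ⟨hsD, hs⟩ <;> rcases hs' with ⟨hsD', hs'⟩ | ⟨hsD', hs'⟩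
    exacts [ha.inj hs hs', absurd hsD hsD', absurd hsD' hsD, hb.inj hs hs']

/-- A step of an alternating path: some buyer is matched to `s` by `a` and to `t` by `b`. -/
def ExchangeStep (a b : Buyer → Option τ) (s t : τ) : Prop :=
  ∃ i, a i = some s ∧ b i = some t

/-- The sellers on the alternating paths of `a` and `b` that start in `D`. -/
def alternatingReach (a b : Buyer → Option τ) (D : Set τ) : Set τ :=
  {t | ∃ s ∈ D, Relation.ReflTransGen (ExchangeStep a b) s t}

theorem subset_alternatingReach : D ⊆ alternatingReach a b D :=
  fun s hs => ⟨s, hs, .refl⟩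

theorem exists_exchangeStep_of_mem_alternatingReach (hs : s ∈ alternatingReach a b D)
    (hsD : s ∉ D) : ∃ t ∈ alternatingReach a b D, ExchangeStep a b t s := by
  obtain ⟨x, hx, hxs⟩ := hs
  rcases Relation.ReflTransGen.cases_tail hxs with rfl | ⟨t, hxt, hts⟩
  exacts [absurd hx hsD, ⟨t, ⟨x, hx, hxt⟩, hts⟩]

theorem IsMatching.isExchangeClosed_alternatingReach (hb : IsMatching h T b)
    (hD : ∀ i, ∀ s ∈ D, b i = some s → a i = none) :
    IsExchangeClosed a b (alternatingReach a b D) := by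
  refine fun i s t hs ht => ⟨fun ⟨x, hx, hxs⟩ => ⟨x, hx, hxs.tail ⟨i, hs, ht⟩⟩, fun htD => ?_⟩
  have hnot : t ∉ D := fun h => by simp [hD i t h ht] at hs
  obtain ⟨s', hs'D, i', hs', ht'⟩ := exists_exchangeStep_of_mem_alternatingReach htD hnot
  obtain rfl := hb.inj ht ht'
  rwa [Option.some.inj (hs.symm.trans hs')]

/-- The path from `x` is unique, and `y`, which `a` misses, ends it. -/
theorem IsMatching.isSome_of_mem_alternatingReach (ha : IsMatching h T a) (hay : ∀ i, a i ≠ some y)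
    (hy : y ∈ alternatingReach a b {x}) (hs : s ∈ alternatingReach a b {x}) (hi : a i = some s) :
    (b i).isSome := by
  obtain ⟨_, rfl, hxy⟩ := hy
  obtain ⟨_, rfl, hxs⟩ := hs
  have hunique : Relator.RightUnique (ExchangeStep a b) := by
    rintro s t t' ⟨i, hs, ht⟩ ⟨i', hs', ht'⟩
    obtain rfl := ha.inj hs hs'
    exact Option.some.inj (ht.symm.trans ht')
  have hsy : s ≠ y := fun e => hay i (e ▸ hi)
  rcases Relation.ReflTransGen.total_of_right_unique hunique hxs hxy with hsy' | hys
  · obtain rfl | ⟨t, ⟨i', hs', ht⟩, -⟩ := Relation.ReflTransGen.cases_head hsy'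
    · exact absurd rfl hsy
    · rw [ha.inj hi hs', ht, Option.isSome_some]
  · obtain rfl | ⟨t, ⟨i', hy', -⟩, -⟩ := Relation.ReflTransGen.cases_head hys
    exacts [absurd rfl hsy, absurd hy' (hay i')]

/-- Exchanging `b` into `a` on a path from `x` to `y` only changes which sellers are matched. -/
theorem IsMatching.isSome_exchangeOn_alternatingReach (ha : IsMatching h T a)
    (hb : IsMatching h T' b) (hay : ∀ i, a i ≠ some y) (hbx : ∀ i, b i ≠ some x)
    (hy : y ∈ alternatingReach a b {x}) :
    (exchangeOn (alternatingReach a b {x}) b a i).isSome = (a i).isSome := by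
  unfold exchangeOn
  split_ifs with hi
  · obtain ⟨s, hs, hbs | has⟩ := hi
    · have hsx : s ≠ x := fun e => hbx i (e ▸ hbs)
      obtain ⟨t, -, i', hat, hbs'⟩ := exists_exchangeStep_of_mem_alternatingReach hs hsx
      rw [hb.inj hbs hbs', hat, hbs']
      rfl
    · rw [ha.isSome_of_mem_alternatingReach hay hy hs has, has]
      rfl
  · rfl

end Matching

section Weight

variable {Buyer τ : Type*} {h : Buyer → τ → Prop} {v : Buyer → τ → ℝ} {T T' F F' : Finset τ}
  {a b : Buyer → Option τ} {i : Buyer} {j k x y : τ}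

theorem finite_setOf_isMatching [Finite Buyer] (h : Buyer → τ → Prop) (T : Finset τ) :
    {a | IsMatching h T a}.Finite := by
  refine (Set.Finite.pi' fun _ : Buyer => Set.toFinite (insert none (some '' (T : Set τ)))).subset
    fun a ha i => ?_
  cases hi : a i with
  | none => simp
  | some s => simpa using ha.mem hi

variable [Fintype Buyer]

/-- The total value that the buyers derive from the allocation `a`. -/
def matchWeight (v : Buyer → τ → ℝ) (a : Buyer → Option τ) : ℝ :=
  ∑ i, (a i).elim 0 (v i)

theorem matchWeight_update [DecidableEq Buyer] (o : Option τ) :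
    matchWeight v (Function.update a i o) + (a i).elim 0 (v i) =
      matchWeight v a + o.elim 0 (v i) := by
  have hrest : ∑ i' ∈ Finset.univ.erase i, (Function.update a i o i').elim 0 (v i') =
      ∑ i' ∈ Finset.univ.erase i, (a i').elim 0 (v i') :=
    Finset.sum_congr rfl fun i' hi' => by rw [Function.update_of_ne (Finset.ne_of_mem_erase hi')]
  simp only [matchWeight, ← Finset.add_sum_erase _ _ (Finset.mem_univ i), hrest,
    Function.update_self]
  ring

theorem matchWeight_exchangeOn_add (D : Set τ) :
    matchWeight v (exchangeOn D a b) + matchWeight v (exchangeOn D b a) =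
      matchWeight v a + matchWeight v b := by
  simp only [matchWeight, ← Finset.sum_add_distrib]
  refine Finset.sum_congr rfl fun i _ => ?_
  have hcomm : (∃ s ∈ D, b i = some s ∨ a i = some s) ↔ ∃ s ∈ D, a i = some s ∨ b i = some s := by
    simp only [or_comm]
  by_cases hi : ∃ s ∈ D, a i = some s ∨ b i = some s
  · simp only [exchangeOn, if_pos hi, if_pos (hcomm.2 hi)]
  · simp only [exchangeOn, if_neg hi, if_neg (hcomm.not.2 hi), add_comm]

/-- The largest total value of a matching to `T`; it is attained, by `exists_optimal_matching`. -/
noncomputable def optWeight (h : Buyer → τ → Prop) (v : Buyer → τ → ℝ) (T : Finset τ) : ℝ :=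
  sSup (matchWeight v '' {a | IsMatching h T a})

theorem IsMatching.matchWeight_le_optWeight (ha : IsMatching h T a) :
    matchWeight v a ≤ optWeight h v T :=
  le_csSup ((finite_setOf_isMatching h T).image _).bddAbove (Set.mem_image_of_mem _ ha)

theorem exists_optimal_matching (h : Buyer → τ → Prop) (v : Buyer → τ → ℝ) (T : Finset τ) :
    ∃ a, IsMatching h T a ∧ matchWeight v a = optWeight h v T :=
  Set.Nonempty.csSup_mem (s := matchWeight v '' {a | IsMatching h T a})
    ⟨_, _, isMatching_none, rfl⟩ ((finite_setOf_isMatching h T).image _)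

theorem optWeight_mono (hT : T ⊆ T') : optWeight h v T ≤ optWeight h v T' := by
  obtain ⟨a, ha, hopt⟩ := exists_optimal_matching h v T
  exact hopt ▸ (ha.of_forall_mem fun hs => hT (ha.mem hs)).matchWeight_le_optWeight

theorem optWeight_le_of_injOn {σ : Type*} {h' : Buyer → σ → Prop} {v' : Buyer → σ → ℝ}
    {T' : Finset σ} {e : τ → σ} (he : Set.InjOn e T) (hT : ∀ s ∈ T, e s ∈ T')
    (hl : ∀ i, ∀ s ∈ T, h i s → h' i (e s) ∧ v i s ≤ v' i (e s)) :
    optWeight h v T ≤ optWeight h' v' T' := by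
  obtain ⟨a, ha, hopt⟩ := exists_optimal_matching h v T
  rw [← hopt]
  refine le_trans (Finset.sum_le_sum fun i _ => ?_)
    (ha.map he hT fun i s hs hi => (hl i s hs hi).1).matchWeight_le_optWeight
  cases hi : a i with
  | none => simp [hi]
  | some s => simpa [hi] using (hl i s (ha.mem hi) (ha.link hi)).2

theorem optWeight_image {σ : Type*} [DecidableEq σ] {h : Buyer → σ → Prop} {v : Buyer → σ → ℝ}
    {e : τ → σ} {f : σ → τ} (hf : Function.LeftInverse f e) :
    optWeight h v (T.image e) =
      optWeight (fun i s => h i (e s)) (fun i s => v i (e s)) T := by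
  refine le_antisymm (optWeight_le_of_injOn (e := f) ?_ ?_ ?_)
    (optWeight_le_of_injOn hf.injective.injOn (fun s hs => Finset.mem_image_of_mem e hs)
      fun i s _ hs => ⟨hs, le_rfl⟩)
  · rw [Finset.coe_image]
    exact (hf.rightInvOn_range.mono (Set.image_subset_range e _)).injOn
  · simp only [Finset.forall_mem_image, hf _, imp_self, implies_true]
  · simp only [Finset.forall_mem_image, hf _]
    exact fun i s _ hs => ⟨hs, le_rfl⟩

variable [DecidableEq τ]

theorem optWeight_insert_le_optWeight_insert (hy : y ∉ F)
    (hxy : ∀ i, h i x → h i y ∧ v i x ≤ v i y) :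
    optWeight h v (insert x F) ≤ optWeight h v (insert y F) := by
  have hswap : ∀ s ∈ F, s ≠ x → Equiv.swap x y s = s := fun s hs hsx =>
    Equiv.swap_apply_of_ne_of_ne hsx fun e => hy (e ▸ hs)
  refine optWeight_le_of_injOn (e := Equiv.swap x y) (Equiv.injective _).injOn ?_ ?_ <;>
    intros <;> grind [Equiv.swap_apply_left]

/-- The component of the buyer `i` in the union of `a` and an optimal matching to
`(insert j F).erase k` misses `k`. After an exchange on this component the buyer `i` is free in
one of the two new matchings and can be matched to `k`. -/
theorem IsMatching.matchWeight_add_optWeight_erase_le (ha : IsMatching h F a) (hi : a i = none)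
    (hk : k ∈ insert j F) (hik : h i k) :
    matchWeight v a + v i k + optWeight h v ((insert j F).erase k) ≤
      optWeight h v F + optWeight h v (insert j F) := by
  classical
  obtain ⟨b, hb, hopt⟩ := exists_optimal_matching h v ((insert j F).erase k)
  set D := alternatingReach a b {t | b i = some t}
  have hD : IsExchangeClosed a b D :=
    hb.isExchangeClosed_alternatingReach fun i' t ht ht' => hb.inj ht ht' ▸ hi
  have hkD : k ∉ D := fun hkD => by
    have hbk : ∀ i', b i' ≠ some k := fun i' e => Finset.notMem_erase k _ (hb.mem e)
    obtain ⟨-, -, i', -, e⟩ := exists_exchangeStep_of_mem_alternatingReach hkD (hbk i)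
    exact hbk i' e
  have hfree : exchangeOn D a b i = none := by
    refine Option.eq_none_iff_forall_ne_some.2 fun t ht => ?_
    rcases (exchangeOn_eq_some_iff hD).1 ht with ⟨-, e⟩ | ⟨htD, e⟩
    · simp [hi] at e
    · exact htD (subset_alternatingReach e)
  have hweight : matchWeight v (Function.update (exchangeOn D a b) i (some k)) +
      matchWeight v (exchangeOn D b a) = matchWeight v a + v i k + matchWeight v b := by
    have hupdate := matchWeight_update (v := v) (a := exchangeOn D a b) (i := i) (some k)
    simp only [hfree, Option.elim_none, add_zero, Option.elim_some] at hupdate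
    linarith [matchWeight_exchangeOn_add (v := v) (a := a) (b := b) D]
  rw [← hopt, ← hweight]
  by_cases hj : j ∈ D
  · exact add_le_add
      ((ha.exchange hb hD (by grind) (by grind)).update_some (by grind)
        hik).matchWeight_le_optWeight
      (hb.exchange ha hD.symm (by grind) (by grind)).matchWeight_le_optWeight
  · rw [add_comm (optWeight h v F)]
    exact add_le_add
      ((ha.exchange hb hD (by grind) (by grind)).update_some hk hik).matchWeight_le_optWeight
      (hb.exchange ha hD.symm (by grind) (by grind)).matchWeight_le_optWeight

/-- The increase of the largest total value when the seller `x` joins the sellers `F`. -/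
noncomputable def marginalWeight (h : Buyer → τ → Prop) (v : Buyer → τ → ℝ) (F : Finset τ)
    (x : τ) : ℝ :=
  optWeight h v (insert x F) - optWeight h v F

theorem marginalWeight_nonneg : 0 ≤ marginalWeight h v F x :=
  sub_nonneg.2 (optWeight_mono (Finset.subset_insert x F))

theorem marginalWeight_of_mem (hx : x ∈ F) : marginalWeight h v F x = 0 := by
  rw [marginalWeight, Finset.insert_eq_self.2 hx, sub_self]

theorem marginalWeight_add_marginalWeight_insert_comm (h : Buyer → τ → Prop) (v : Buyer → τ → ℝ)
    (F : Finset τ) (x y : τ) :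
    marginalWeight h v F x + marginalWeight h v (insert x F) y =
      marginalWeight h v F y + marginalWeight h v (insert y F) x := by
  simp only [marginalWeight, Finset.insert_comm x y]
  ring

theorem marginalWeight_le_marginalWeight (hy : y ∉ F) (hxy : ∀ i, h i x → h i y ∧ v i x ≤ v i y) :
    marginalWeight h v F x ≤ marginalWeight h v F y :=
  sub_le_sub_right (optWeight_insert_le_optWeight_insert hy hxy) _

theorem marginalWeight_congr (hx : x ∉ F) (hy : y ∉ F) (hh : ∀ i, h i x ↔ h i y)
    (hv : ∀ i, v i x = v i y) : marginalWeight h v F x = marginalWeight h v F y :=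
  (marginalWeight_le_marginalWeight hy fun i hi => ⟨(hh i).1 hi, (hv i).le⟩).antisymm
    (marginalWeight_le_marginalWeight hx fun i hi => ⟨(hh i).2 hi, (hv i).ge⟩)

theorem marginalWeight_insert_congr {z : τ} (hx : x ∉ insert z F) (hy : y ∉ insert z F)
    (hh : ∀ i, h i x ↔ h i y) (hv : ∀ i, v i x = v i y) :
    marginalWeight h v (insert x F) z = marginalWeight h v (insert y F) z := by
  have hF : marginalWeight h v F x = marginalWeight h v F y :=
    marginalWeight_congr (fun hF => hx (Finset.mem_insert_of_mem hF))
      (fun hF => hy (Finset.mem_insert_of_mem hF)) hh hv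
  have hcomm := marginalWeight_add_marginalWeight_insert_comm h v F
  linarith [hcomm x z, hcomm y z, marginalWeight_congr hx hy hh hv]

theorem marginalWeight_anti (hF : F ⊆ F') : marginalWeight h v F' x ≤ marginalWeight h v F x := by
  by_cases hx : x ∈ F'
  · exact (marginalWeight_of_mem hx).trans_le marginalWeight_nonneg
  obtain ⟨a, ha, hopta⟩ := exists_optimal_matching h v (insert x F')
  obtain ⟨b, hb, hoptb⟩ := exists_optimal_matching h v F
  set D := alternatingReach a b {x}
  have hbx : ∀ i, b i ≠ some x := fun i e => hx (hF (hb.mem e))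
  have hD : IsExchangeClosed a b D :=
    hb.isExchangeClosed_alternatingReach fun i _ ht e => absurd (ht ▸ e) (hbx i)
  have hxD : x ∈ D := subset_alternatingReach rfl
  have hDF : ∀ s ∈ D, s ∈ insert x F := fun s hs => by
    by_cases hsx : s = x
    · simp [hsx]
    · obtain ⟨-, -, i, -, e⟩ := exists_exchangeStep_of_mem_alternatingReach hs hsx
      exact Finset.mem_insert_of_mem (hb.mem e)
  have hweight := matchWeight_exchangeOn_add (v := v) (a := a) (b := b) D
  have hle : matchWeight v (exchangeOn D a b) ≤ optWeight h v (insert x F) :=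
    (ha.exchange hb hD (fun s _ => hDF s) (by grind)).matchWeight_le_optWeight
  have hle' : matchWeight v (exchangeOn D b a) ≤ optWeight h v F' :=
    (hb.exchange ha hD.symm (by grind) (by grind)).matchWeight_le_optWeight
  simp only [marginalWeight]
  linarith

end Weight

section CompetitivePrices

variable {Buyer τ : Type*} {h : Buyer → τ → Prop} {v : Buyer → τ → ℝ} {p : τ → ℝ}
  {T : Finset τ} {a b : Buyer → Option τ} {j : τ}

theorem IsCompetitiveEquilibrium.isMatching [Fintype τ]
    (ha : IsCompetitiveEquilibrium v h p a) :
    IsMatching h Finset.univ a :=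
  ⟨fun _ => Finset.mem_univ _, ha.respects_links _ _, ha.sold_at_most_once _ _ _⟩

section Clearing

variable [Fintype Buyer]

theorem IsMatching.sum_elim_eq_sum_filter (ha : IsMatching h T a)
    [DecidablePred fun s => ∃ i, a i = some s] :
    ∑ i, (a i).elim 0 p = ∑ s ∈ T with ∃ i, a i = some s, p s := by
  classical
  have helim : ∀ i, (a i).elim 0 p = ∑ s ∈ T, if a i = some s then p s else 0 := fun i => by
    cases hi : a i with
    | none => simp
    | some s => simp [ha.mem hi]
  simp only [helim, Finset.sum_filter]
  rw [Finset.sum_comm]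
  refine Finset.sum_congr rfl fun s _ => ?_
  split_ifs with hs
  · obtain ⟨i, hi⟩ := hs
    rw [Finset.sum_eq_single_of_mem i (Finset.mem_univ i) fun i' _ hne =>
      if_neg fun e => hne (ha.inj e hi), if_pos hi]
  · exact Finset.sum_eq_zero fun i _ => if_neg fun e => hs ⟨i, e⟩

theorem IsCompetitiveEquilibrium.matchWeight_le (ha : IsCompetitiveEquilibrium v h p a)
    (hb : IsMatching h T b) :
    matchWeight v b ≤ ∑ i, buyerUtility v p i (a i) + ∑ s ∈ T, p s := by
  classical
  have hpaid : ∑ i, (b i).elim 0 p ≤ ∑ s ∈ T, p s := by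
    rw [hb.sum_elim_eq_sum_filter]
    exact Finset.sum_le_sum_of_subset_of_nonneg (Finset.filter_subset _ _)
      fun s _ _ => ha.price_nonneg s
  refine le_trans ?_ (add_le_add_right hpaid _)
  rw [← Finset.sum_add_distrib]
  refine Finset.sum_le_sum fun i _ => ?_
  cases hi : b i with
  | none => simpa using ha.utility_nonneg i
  | some s => exact sub_le_iff_le_add.1 (ha.most_preferred i s (hb.link hi))

variable [Fintype τ]

theorem IsCompetitiveEquilibrium.matchWeight_eq (ha : IsCompetitiveEquilibrium v h p a) :
    matchWeight v a = ∑ i, buyerUtility v p i (a i) + ∑ s, p s := by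
  classical
  have hpaid : ∑ i, (a i).elim 0 p = ∑ s, p s := by
    rw [ha.isMatching.sum_elim_eq_sum_filter]
    refine Finset.sum_filter_of_ne fun s _ hs => ?_
    by_contra! hunsold
    exact hs (ha.unsold_price_zero s hunsold)
  rw [← hpaid, ← Finset.sum_add_distrib]
  refine Finset.sum_congr rfl fun i _ => ?_
  cases a i <;> simp [buyerUtility]

variable [DecidableEq τ]

theorem marginalWeight_compl_singleton :
    marginalWeight h v {j}ᶜ j =
      optWeight h v Finset.univ - optWeight h v (Finset.univ.erase j) := by
  rw [marginalWeight, Finset.insert_compl_self, Finset.compl_singleton]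

theorem IsCompetitivePrice.le_marginalWeight (hp : IsCompetitivePrice v h p) (j : τ) :
    p j ≤ marginalWeight h v {j}ᶜ j := by
  obtain ⟨a, ha⟩ := hp
  obtain ⟨b, hb, hopt⟩ := exists_optimal_matching h v (Finset.univ.erase j)
  rw [marginalWeight_compl_singleton]
  linarith [ha.isMatching.matchWeight_le_optWeight (v := v), ha.matchWeight_eq,
    ha.matchWeight_le hb, Finset.add_sum_erase Finset.univ p (Finset.mem_univ j)]

/-- The allocation is any optimal matching. If it gives `j` to the buyer `i`, then
`matchWeight_add_optWeight_erase_le`, applied after `i` has given `j` back, shows that `i` does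
not prefer another seller. -/
theorem isCompetitivePrice_marginalWeight :
    IsCompetitivePrice v h fun j => marginalWeight h v {j}ᶜ j := by
  classical
  obtain ⟨a, ha, hopt⟩ := exists_optimal_matching h v Finset.univ
  have hreturn : ∀ {i j}, a i = some j →
      matchWeight v (Function.update a i none) + v i j = optWeight h v Finset.univ :=
    fun {i j} hi => by simpa [hi, hopt] using matchWeight_update (v := v) (a := a) (i := i) none
  refine ⟨a, fun _ => marginalWeight_nonneg, fun _ _ => ha.link, fun _ _ _ => ha.inj,
    fun i k hik => ?_, fun i => ?_, fun j hj => ?_⟩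
  · cases hi : a i with
    | none =>
      have hle := ha.matchWeight_add_optWeight_erase_le (v := v) (j := k) hi (by simp) hik
      simp only [Finset.insert_eq_self.2 (Finset.mem_univ k)] at hle
      simp only [buyerUtility, marginalWeight_compl_singleton]
      linarith
    | some j =>
      have hle := (ha.update_none hi).matchWeight_add_optWeight_erase_le (v := v) (j := j)
        (Function.update_self ..) (by simp) hik
      simp only [Finset.insert_erase (Finset.mem_univ j)] at hle
      simp only [buyerUtility, marginalWeight_compl_singleton]
      linarith [hreturn hi]
  · cases hi : a i with
    | none => exact le_rfl
    | some j =>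
      simp only [buyerUtility, marginalWeight_compl_singleton]
      linarith [hreturn hi, (ha.update_none hi).matchWeight_le_optWeight (v := v)]
  · have hunsold : IsMatching h (Finset.univ.erase j) a :=
      ha.of_forall_mem fun hs => Finset.mem_erase.2 ⟨fun e => hj _ (e ▸ hs), ha.mem hs⟩
    refine le_antisymm ?_ marginalWeight_nonneg
    rw [marginalWeight_compl_singleton, ← hopt]
    exact sub_nonpos.2 hunsold.matchWeight_le_optWeight

theorem maxPrice_eq_marginalWeight : maxPrice v h = fun j => marginalWeight h v {j}ᶜ j := by
  funext j
  refine IsGreatest.csSup_eq ⟨⟨_, isCompetitivePrice_marginalWeight, rfl⟩, ?_⟩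
  rintro _ ⟨p, hp, rfl⟩
  exact hp.le_marginalWeight j

end Clearing

variable [Finite Buyer] [Finite τ]

theorem isGreatest_maxPrice : IsGreatest {p | IsCompetitivePrice v h p} (maxPrice v h) := by
  classical
  cases nonempty_fintype Buyer
  cases nonempty_fintype τ
  rw [maxPrice_eq_marginalWeight]
  exact ⟨isCompetitivePrice_marginalWeight, fun p hp j => hp.le_marginalWeight j⟩

theorem maxPrice_nonneg : 0 ≤ maxPrice v h j := by
  obtain ⟨_, ha⟩ := isGreatest_maxPrice (v := v) (h := h).1
  exact ha.price_nonneg j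

end CompetitivePrices

section HomogeneousGoods

variable {Buyer τ : Type*} [Fintype Buyer] {h : Buyer → τ → Prop} {w : Buyer → ℝ}
  {F : Finset τ} {a b : Buyer → Option τ} {x y u u' : τ}

theorem matchWeight_homogeneousValue_congr (hab : ∀ i, (a i).isSome = (b i).isSome) :
    matchWeight (homogeneousValue w) a = matchWeight (homogeneousValue w) b := by
  refine Finset.sum_congr rfl fun i _ => ?_
  have hi := hab i
  cases ha : a i <;> cases hb : b i <;> simp_all [homogeneousValue]

variable [DecidableEq τ]

local notation "Δ" => marginalWeight h (homogeneousValue w)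

/-- Start from an optimal matching to `insert x F` and one to `insert y F`. If the alternating path
from `x` reached `y`, then an exchange along it would let the buyers matched to `insert x F` be
matched to `insert y F`. Since it does not, `x` can be moved between the two matchings. -/
theorem marginalWeight_insert_of_lt (hlt : Δ F y < Δ F x) : Δ (insert y F) x = Δ F x := by
  refine le_antisymm (marginalWeight_anti (Finset.subset_insert y F)) ?_
  have hxy : x ≠ y := by rintro rfl; exact lt_irrefl _ hlt
  have hx : x ∉ F := fun hx => (marginalWeight_nonneg.trans_lt hlt).ne' (marginalWeight_of_mem hx)
  by_cases hyF : y ∈ F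
  · rw [Finset.insert_eq_self.2 hyF]
  obtain ⟨a, ha, hopta⟩ := exists_optimal_matching h (homogeneousValue w) (insert x F)
  obtain ⟨b, hb, hoptb⟩ := exists_optimal_matching h (homogeneousValue w) (insert y F)
  have hay : ∀ i, a i ≠ some y := fun i e => by simpa [hxy.symm, hyF] using ha.mem e
  have hbx : ∀ i, b i ≠ some x := fun i e => by simpa [hxy, hx] using hb.mem e
  set D := alternatingReach a b {x}
  have hD : IsExchangeClosed a b D :=
    hb.isExchangeClosed_alternatingReach fun i _ ht e => absurd (ht ▸ e) (hbx i)
  have hxD : x ∈ D := subset_alternatingReach rfl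
  have hyD : y ∉ D := fun hyD => by
    have hle := (hb.exchange ha hD.symm (T' := insert y F) (by grind)
      (by grind)).matchWeight_le_optWeight (v := homogeneousValue w)
    rw [matchWeight_homogeneousValue_congr fun i =>
      ha.isSome_exchangeOn_alternatingReach hb hay hbx hyD, hopta] at hle
    exact hlt.not_ge (sub_le_sub_right hle _)
  have hle : matchWeight (homogeneousValue w) (exchangeOn D a b) ≤
      optWeight h (homogeneousValue w) (insert x (insert y F)) :=
    (ha.exchange hb hD (by grind) (by grind)).matchWeight_le_optWeight
  have hle' : matchWeight (homogeneousValue w) (exchangeOn D b a) ≤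
      optWeight h (homogeneousValue w) F :=
    (hb.exchange ha hD.symm (by grind) (by grind)).matchWeight_le_optWeight
  have hsum := matchWeight_exchangeOn_add (v := homogeneousValue w) (a := a) (b := b) D
  simp only [marginalWeight]
  linarith

theorem marginalWeight_eq_max (hu : u ∉ F) (hxu : ∀ i, h i x → h i u) :
    Δ F u = max (Δ F x) (Δ (insert x F) u) := by
  have hle : Δ F x ≤ Δ F u := marginalWeight_le_marginalWeight hu fun i hi => ⟨hxu i hi, le_rfl⟩
  rcases hle.eq_or_lt with heq | hlt
  · rw [heq, max_eq_left (marginalWeight_anti (Finset.subset_insert x F))]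
  · rw [marginalWeight_insert_of_lt hlt, max_eq_right hle]

theorem marginalWeight_insert_le_of_forall_link (hu : u ∉ insert x F) (hu' : u' ∉ insert u F)
    (hlink : ∀ i, h i u) (hlink' : ∀ i, h i u') : Δ (insert u F) u' ≤ Δ (insert x F) u := by
  have hdom : ∀ y (F : Finset τ), u ∉ F → Δ F y ≤ Δ F u := fun y F hu =>
    marginalWeight_le_marginalWeight hu fun i _ => ⟨hlink i, le_rfl⟩
  rw [marginalWeight_eq_max hu' (x := x) fun i _ => hlink' i, Finset.insert_comm]
  refine max_le ?_ ((marginalWeight_anti (Finset.subset_insert u _)).trans (hdom u' _ hu))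
  have hcomm := marginalWeight_add_marginalWeight_insert_comm h (homogeneousValue w) F x u
  linarith [hdom x F fun hF => hu (Finset.mem_insert_of_mem hF)]

theorem marginalWeight_insert_le_of_le (hu : u ∉ insert x F) (hlink : ∀ i, h i u)
    (hle : Δ F y ≤ Δ F x) : Δ (insert x F) y ≤ Δ (insert u F) x := by
  have hcomm := marginalWeight_add_marginalWeight_insert_comm h (homogeneousValue w) F x u
  have hxu : Δ F x ≤ Δ F u :=
    marginalWeight_le_marginalWeight (fun hF => hu (Finset.mem_insert_of_mem hF))
      fun i _ => ⟨hlink i, le_rfl⟩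
  rcases hxu.eq_or_lt with heq | hlt
  · have hyu : Δ (insert x F) y ≤ Δ (insert x F) u :=
      marginalWeight_le_marginalWeight hu fun i _ => ⟨hlink i, le_rfl⟩
    linarith
  · have hyF : Δ (insert x F) y ≤ Δ F y := marginalWeight_anti (Finset.subset_insert x F)
    linarith [marginalWeight_insert_of_lt hlt]

theorem marginalWeight_insert_le_marginalWeight_insert
    (hle : Δ (insert y F) x ≤ Δ (insert u F) y) : Δ (insert u F) x ≤ Δ (insert u F) y := by
  by_contra! hlt
  have hxF : Δ (insert y (insert u F)) x ≤ Δ (insert y F) x :=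
    marginalWeight_anti (Finset.insert_subset_insert y (Finset.subset_insert u F))
  linarith [marginalWeight_insert_of_lt hlt]

end HomogeneousGoods

section Prices

variable {Buyer Seller : Type*} [DecidableEq Seller] {P Q T : Finset Seller} {j k : Seller}
  {c : Bool} {g : Buyer → Seller → Prop} {w : Buyer → ℝ}

/-- The network in which each seller has a copy off the platform (`false`), with her own links, and
a copy on the platform (`true`), linked to all buyers. Prices under different sets of sellers on
the platform become marginal weights in this one network. -/
def copiesNetwork (g : Buyer → Seller → Prop) : Buyer → Seller × Bool → Prop :=
  fun i s => s.2 = true ∨ g i s.1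

/-- The copies of the sellers in `T` that are present when `P` is on the platform. -/
def copies (P T : Finset Seller) : Finset (Seller × Bool) :=
  T.image fun j => (j, decide (j ∈ P))

theorem mem_copies : (j, c) ∈ copies P T ↔ j ∈ T ∧ decide (j ∈ P) = c := by
  simp only [copies, Finset.mem_image, Prod.mk.injEq]
  exact ⟨fun ⟨_, hk, rfl, hc⟩ => ⟨hk, hc⟩, fun ⟨hj, hc⟩ => ⟨j, hj, rfl, hc⟩⟩

theorem copies_congr (hPQ : ∀ k ∈ T, k ∈ P ↔ k ∈ Q) : copies P T = copies Q T :=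
  Finset.image_congr fun k hk => by simp only [hPQ k hk]

local notation "Δ" => marginalWeight (copiesNetwork g) (homogeneousValue w)
local notation "pOff" => offPrice (homogeneousValue w) g
local notation "pOn" => onPrice (homogeneousValue w) g

section Copies

variable [Fintype Seller]

theorem copies_univ : copies P Finset.univ = insert (j, decide (j ∈ P)) (copies P {j}ᶜ) := by
  rw [← Finset.insert_compl_self j, copies, Finset.image_insert, copies]

theorem copies_compl_singleton (hjk : j ≠ k) :
    copies P {j}ᶜ = insert (k, decide (k ∈ P)) (copies P {j, k}ᶜ) := by
  rw [copies, copies, ← Finset.image_insert (fun k => (k, decide (k ∈ P)))]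
  congr 1
  grind [Finset.mem_compl]

theorem copies_insert_compl_singleton (hjk : j ≠ k) :
    copies (insert k P) {j}ᶜ = insert (k, true) (copies P {j, k}ᶜ) := by
  rw [copies_compl_singleton hjk, decide_eq_true (Finset.mem_insert_self k P)]
  congr 1
  exact copies_congr fun s hs => by grind [Finset.mem_compl]

variable [Fintype Buyer]

theorem platformPrice_eq_marginalWeight :
    platformPrice (homogeneousValue w) g P j = Δ (copies P {j}ᶜ) (j, decide (j ∈ P)) := by
  have himage : ∀ T, optWeight (platformGraph g P) (homogeneousValue w) T =
      optWeight (copiesNetwork g) (homogeneousValue w) (copies P T) := fun T => by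
    rw [copies, optWeight_image (f := Prod.fst) fun _ => rfl]
    simp only [copiesNetwork, decide_eq_true_eq]
    rfl
  simp only [platformPrice, maxPrice_eq_marginalWeight, marginalWeight, himage,
    Finset.insert_compl_self, ← copies_univ]

theorem offPrice_eq_marginalWeight : pOff P j = Δ (copies P {j}ᶜ) (j, false) := by
  rw [offPrice, platformPrice_eq_marginalWeight, decide_eq_false (Finset.notMem_erase j P),
    copies_congr (Q := P) fun k hk => by grind [Finset.mem_compl]]

theorem onPrice_eq_marginalWeight : pOn P j = Δ (copies P {j}ᶜ) (j, true) := by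
  rw [onPrice, platformPrice_eq_marginalWeight, decide_eq_true (Finset.mem_insert_self j P),
    copies_congr (Q := P) fun k hk => by grind [Finset.mem_compl]]

end Copies

variable [Finite Buyer] [Finite Seller]

theorem onPrice_eq_of_mem (hj : j ∈ P) (hk : k ∈ P) : pOn P j = pOn P k := by
  cases nonempty_fintype Buyer
  cases nonempty_fintype Seller
  obtain rfl | hjk := eq_or_ne j k
  · rfl
  have hcomm := marginalWeight_add_marginalWeight_insert_comm (copiesNetwork g) (homogeneousValue w)
    (copies P {j, k}ᶜ) (j, true) (k, true)
  have hcongr : Δ (copies P {j, k}ᶜ) (j, true) = Δ (copies P {j, k}ᶜ) (k, true) :=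
    marginalWeight_congr (by simp [mem_copies]) (by simp [mem_copies])
      (fun i => by simp [copiesNetwork]) fun i => rfl
  rw [onPrice_eq_marginalWeight, onPrice_eq_marginalWeight, copies_compl_singleton hjk,
    copies_compl_singleton hjk.symm, Finset.pair_comm k j, decide_eq_true hj, decide_eq_true hk]
  linarith

theorem offPrice_le_onPrice : pOff P j ≤ pOn P j := by
  cases nonempty_fintype Buyer
  cases nonempty_fintype Seller
  rw [offPrice_eq_marginalWeight, onPrice_eq_marginalWeight]
  exact marginalWeight_le_marginalWeight (by simp [mem_copies]) fun i _ => ⟨.inl rfl, le_rfl⟩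

theorem onPrice_le_max (hj : j ∉ P) (hk : k ∉ P) : pOn P j ≤ max (pOff P j) (pOn P k) := by
  cases nonempty_fintype Buyer
  cases nonempty_fintype Seller
  have hjon : pOn P j = max (pOff P j) (Δ (copies P Finset.univ) (j, true)) := by
    rw [onPrice_eq_marginalWeight, offPrice_eq_marginalWeight, copies_univ (j := j),
      decide_eq_false hj]
    exact marginalWeight_eq_max (by simp [mem_copies]) fun i _ => .inl rfl
  rw [hjon]
  refine max_le_max_left _ ?_
  calc Δ (copies P Finset.univ) (j, true)
      ≤ Δ (copies P Finset.univ) (k, true) :=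
        marginalWeight_le_marginalWeight (by simp [mem_copies, hk]) fun i _ => ⟨.inl rfl, le_rfl⟩
    _ ≤ Δ (copies P {k}ᶜ) (k, true) :=
        marginalWeight_anti (Finset.image_subset_image (Finset.subset_univ _))
    _ = pOn P k := onPrice_eq_marginalWeight.symm

theorem onPrice_insert_le (hj : j ∉ P) (hjk : j ≠ k) : pOn (insert k P) j ≤ pOn P k := by
  cases nonempty_fintype Buyer
  cases nonempty_fintype Seller
  rw [onPrice_eq_marginalWeight, onPrice_eq_marginalWeight, copies_insert_compl_singleton hjk,
    copies_compl_singleton hjk.symm, Finset.pair_comm k j, decide_eq_false hj]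
  exact marginalWeight_insert_le_of_forall_link (by simp [mem_copies])
    (by simp [mem_copies, hjk]) (fun _ => .inl rfl) fun _ => .inl rfl

theorem offPrice_le_offPrice_insert (hj : j ∉ P) (hk : k ∉ P) (hjk : j ≠ k)
    (hle : pOff P k ≤ pOff P j) : pOff P k ≤ pOff (insert k P) j := by
  cases nonempty_fintype Buyer
  cases nonempty_fintype Seller
  have hcomm := marginalWeight_add_marginalWeight_insert_comm (copiesNetwork g) (homogeneousValue w)
    (copies P {j, k}ᶜ) (j, false) (k, false)
  simp only [offPrice_eq_marginalWeight, copies_insert_compl_singleton hjk,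
    copies_compl_singleton hjk, copies_compl_singleton hjk.symm, Finset.pair_comm k j,
    decide_eq_false hj, decide_eq_false hk] at hle ⊢
  exact marginalWeight_insert_le_of_le (by simp [mem_copies]) (fun _ => .inl rfl) (by linarith)

theorem offPrice_insert_le (hj : j ∈ P) (hk : k ∉ P) (hle : pOff P j ≤ pOff P k) :
    pOff (insert k P) j ≤ pOff P k := by
  cases nonempty_fintype Buyer
  cases nonempty_fintype Seller
  have hjk : j ≠ k := by rintro rfl; exact hk hj
  have hcongr : Δ (insert (k, true) (copies P {j, k}ᶜ)) (j, false) =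
      Δ (insert (j, true) (copies P {j, k}ᶜ)) (j, false) :=
    marginalWeight_insert_congr (by simp [mem_copies]) (by simp [mem_copies])
      (fun _ => by simp [copiesNetwork]) fun _ => rfl
  simp only [offPrice_eq_marginalWeight, copies_insert_compl_singleton hjk,
    copies_compl_singleton hjk, copies_compl_singleton hjk.symm, Finset.pair_comm k j,
    decide_eq_true hj, decide_eq_false hk] at hle ⊢
  rw [hcongr]
  exact marginalWeight_insert_le_marginalWeight_insert hle

end Prices

section Gain

variable {Buyer Seller : Type*} [DecidableEq Seller] {v : Buyer → Seller → ℝ}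
  {g : Buyer → Seller → Prop} {w : Buyer → ℝ} {α β : ℝ} {P : Finset Seller} {j k : Seller}

theorem isPurePlatformEquilibrium_iff_gain :
    IsPurePlatformEquilibrium v g α P ↔
      (∀ j ∈ P, 0 ≤ gain v g α P j) ∧ ∀ j ∉ P, gain v g α P j ≤ 0 := by
  refine and_congr (forall₂_congr fun j hj => ?_) (forall₂_congr fun j hj => ?_)
  · rw [gain, onPrice, Finset.insert_eq_self.2 hj, offPrice, sub_nonneg]
  · rw [gain, onPrice, offPrice, Finset.erase_eq_of_notMem hj, sub_nonpos]

theorem gain_sub_gain : gain v g α P j - gain v g β P j = (β - α) * onPrice v g P j := by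
  simp only [gain]
  ring

theorem exists_gain_eq_zero (hαβ : α ≤ β) (hα : 0 ≤ gain v g α P j) (hβ : gain v g β P j ≤ 0) :
    ∃ γ ∈ Set.Icc α β, gain v g γ P j = 0 := by
  have hcont : Continuous fun γ => gain v g γ P j := by
    unfold gain
    fun_prop
  exact intermediate_value_Icc' hαβ hcont.continuousOn ⟨hβ, hα⟩

theorem gain_nonpos_of_forall_neg (hαβ : α ≤ β) (hβ : gain v g β P j ≤ 0)
    (hneg : ∀ γ, α < γ → γ ≤ β → gain v g γ P j < 0) : gain v g α P j ≤ 0 := by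
  by_contra! hpos
  obtain ⟨γ, hγ, hzero⟩ := exists_gain_eq_zero hαβ hpos.le hβ
  have hαγ : α < γ := hγ.1.lt_of_ne (by rintro rfl; exact hpos.ne' hzero)
  exact (hneg γ hαγ hγ.2).ne hzero

variable [Finite Buyer] [Finite Seller]

theorem gain_anti (hαβ : α ≤ β) : gain v g β P j ≤ gain v g α P j := by
  rw [← sub_nonneg, gain_sub_gain]
  exact mul_nonneg (sub_nonneg.2 hαβ) maxPrice_nonneg

theorem gain_one_nonpos : gain v g 1 P j ≤ 0 := by
  rw [gain, sub_self, zero_mul, zero_sub, neg_nonpos]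
  exact maxPrice_nonneg

theorem gain_le_gain_of_offPrice_le (hα : α ∈ Set.Icc (0 : ℝ) 1) (hj : j ∉ P) (hk : k ∉ P)
    (hle : offPrice (homogeneousValue w) g P k ≤ offPrice (homogeneousValue w) g P j) :
    gain (homogeneousValue w) g α P j ≤ gain (homogeneousValue w) g α P k := by
  simp only [gain]
  have hα' := sub_nonneg.2 hα.2
  rcases le_max_iff.1 (onPrice_le_max (g := g) (w := w) hj hk) with hoff | hon
  · linarith [mul_le_mul_of_nonneg_left hoff hα', mul_le_mul_of_nonneg_left hle hα.1,
      mul_le_mul_of_nonneg_left (offPrice_le_onPrice (g := g) (w := w) (P := P) (j := k)) hα']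
  · linarith [mul_le_mul_of_nonneg_left hon hα']

theorem isCandidate_iff (hα : α ∈ Set.Icc (0 : ℝ) 1) :
    IsCandidate (homogeneousValue w) g α P k ↔ k ∉ P ∧ ∀ j ∉ P,
      offPrice (homogeneousValue w) g P k ≤ offPrice (homogeneousValue w) g P j := by
  refine ⟨fun ⟨hk, hmax, hmin⟩ => ⟨hk, fun j hj => ?_⟩, fun ⟨hk, hmin⟩ => ⟨hk, fun j hj =>
    gain_le_gain_of_offPrice_le hα hj hk (hmin j hj), fun j hj _ => hmin j hj⟩⟩
  by_contra! hlt
  have hgain := gain_le_gain_of_offPrice_le hα hk hj hlt.le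
  exact hlt.not_ge (hmin j hj ((hmax j hj).antisymm hgain))

theorem IsCandidate.change_fee (hk : IsCandidate (homogeneousValue w) g α P k)
    (hα : α ∈ Set.Icc (0 : ℝ) 1) (hβ : β ∈ Set.Icc (0 : ℝ) 1) :
    IsCandidate (homogeneousValue w) g β P k :=
  (isCandidate_iff hβ).2 ((isCandidate_iff hα).1 hk)

theorem exists_isCandidate (w : Buyer → ℝ) (g : Buyer → Seller → Prop)
    (hα : α ∈ Set.Icc (0 : ℝ) 1) (hP : ∃ k, k ∉ P) :
    ∃ k, IsCandidate (homogeneousValue w) g α P k := by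
  obtain ⟨k, hk, hmin⟩ := Set.exists_min_image {k | k ∉ P} (offPrice (homogeneousValue w) g P)
    (Set.toFinite _) hP
  exact ⟨k, (isCandidate_iff hα).2 ⟨hk, hmin⟩⟩

theorem exists_gain_eq_zero_of_nonpos (hα : 0 ≤ α)
    (hgain : gain (homogeneousValue w) g α P k ≤ 0) :
    ∃ α' ∈ Set.Icc 0 α, gain (homogeneousValue w) g α' P k = 0 ∧
      ∀ β, α' < β → β ≤ α → gain (homogeneousValue w) g β P k < 0 := by
  rcases hgain.eq_or_lt with hzero | hneg
  · exact ⟨α, ⟨hα, le_rfl⟩, hzero, fun β hlt hle => absurd hle hlt.not_ge⟩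
  have hgain0 : 0 ≤ gain (homogeneousValue w) g 0 P k := by
    simpa [gain] using offPrice_le_onPrice
  obtain ⟨α', hα', hzero⟩ := exists_gain_eq_zero hα hgain0 hgain
  have hon : 0 < onPrice (homogeneousValue w) g P k := by
    refine pos_of_mul_pos_right ?_ (sub_nonneg.2 hα'.2)
    rw [← gain_sub_gain, hzero]
    linarith
  refine ⟨α', hα', hzero, fun β hlt _ => ?_⟩
  have hdiff := mul_pos (sub_pos.2 hlt) hon
  rw [← gain_sub_gain, hzero] at hdiff
  linarith

end Gain

section Sweep

variable {Buyer Seller : Type*} [DecidableEq Seller] {v : Buyer → Seller → ℝ}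
  {g : Buyer → Seller → Prop} {w : Buyer → ℝ} {α α' : ℝ} {P : Finset Seller} {k : Seller}

/-- What holds whenever a sweep reaches the fee `α` with `P` on the platform. The comparison of the
prices off the platform records that sellers join in increasing order of these prices; it is what
keeps the sellers of `P` on the platform when another one joins. -/
structure SweepInvariant (v : Buyer → Seller → ℝ) (g : Buyer → Seller → Prop) (α : ℝ)
    (P : Finset Seller) : Prop where
  fee_mem : α ∈ Set.Icc (0 : ℝ) 1
  isEquilibrium : IsPurePlatformEquilibrium v g α P
  offPrice_le : ∀ j ∈ P, ∀ k ∉ P, offPrice v g P j ≤ offPrice v g P k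
  visits : ∀ β ∈ Set.Icc 0 α, AlgVisits v g β P

theorem SweepInvariant.gain_nonneg (hI : SweepInvariant v g α P) :
    ∀ j ∈ P, 0 ≤ gain v g α P j :=
  (isPurePlatformEquilibrium_iff_gain.1 hI.isEquilibrium).1

theorem SweepInvariant.gain_nonpos (hI : SweepInvariant v g α P) :
    ∀ j ∉ P, gain v g α P j ≤ 0 :=
  (isPurePlatformEquilibrium_iff_gain.1 hI.isEquilibrium).2

variable [Finite Buyer] [Finite Seller]

theorem SweepInvariant.start : SweepInvariant v g 1 ∅ where
  fee_mem := by simp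
  isEquilibrium := isPurePlatformEquilibrium_iff_gain.2 ⟨by simp, fun _ _ => gain_one_nonpos⟩
  offPrice_le := by simp
  visits _ _ := .refl

theorem SweepInvariant.lower (hI : SweepInvariant v g α P) (hα' : 0 ≤ α') (hle : α' ≤ α)
    (hneg : ∀ β, α' < β → β ≤ α → ∀ j ∉ P, gain v g β P j < 0) : SweepInvariant v g α' P where
  fee_mem := ⟨hα', hle.trans hI.fee_mem.2⟩
  isEquilibrium := isPurePlatformEquilibrium_iff_gain.2
    ⟨fun j hj => (hI.gain_nonneg j hj).trans (gain_anti hle), fun j hj =>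
      gain_nonpos_of_forall_neg hle (hI.gain_nonpos j hj) fun β hlt hβ => hneg β hlt hβ j hj⟩
  offPrice_le := hI.offPrice_le
  visits β hβ := hI.visits β ⟨hβ.1, hβ.2.trans hle⟩

theorem SweepInvariant.gain_insert_nonneg (hI : SweepInvariant (homogeneousValue w) g α P)
    (hk : k ∉ P) (hgain : 0 ≤ gain (homogeneousValue w) g α P k) :
    ∀ j ∈ insert k P, 0 ≤ gain (homogeneousValue w) g α (insert k P) j := by
  intro j hj
  have hon : onPrice (homogeneousValue w) g (insert k P) j =
      onPrice (homogeneousValue w) g P k := by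
    rw [onPrice_eq_of_mem hj (Finset.mem_insert_self k P), onPrice, onPrice, Finset.insert_idem]
  have hoff : offPrice (homogeneousValue w) g (insert k P) j ≤
      offPrice (homogeneousValue w) g P k := by
    rcases Finset.mem_insert.1 hj with rfl | hj
    · simp [offPrice]
    · exact offPrice_insert_le hj hk (hI.offPrice_le j hj k hk)
  rw [gain] at hgain ⊢
  rw [hon]
  linarith

theorem SweepInvariant.add (hI : SweepInvariant (homogeneousValue w) g α P)
    (hk : IsCandidate (homogeneousValue w) g α P k)
    (hgain : 0 ≤ gain (homogeneousValue w) g α P k) :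
    SweepInvariant (homogeneousValue w) g α (insert k P) := by
  obtain ⟨hkP, hmin⟩ := (isCandidate_iff hI.fee_mem).1 hk
  have hoff : ∀ j ∉ insert k P, offPrice (homogeneousValue w) g P k ≤
      offPrice (homogeneousValue w) g (insert k P) j := fun j hj => by
    obtain ⟨hjk, hj⟩ := not_or.1 (mt Finset.mem_insert.2 hj)
    exact offPrice_le_offPrice_insert hj hkP hjk (hmin j hj)
  have hon : ∀ j ∉ insert k P, onPrice (homogeneousValue w) g (insert k P) j ≤
      onPrice (homogeneousValue w) g P k := fun j hj => by
    obtain ⟨hjk, hj⟩ := not_or.1 (mt Finset.mem_insert.2 hj)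
    exact onPrice_insert_le hj hjk
  refine ⟨hI.fee_mem, isPurePlatformEquilibrium_iff_gain.2
    ⟨hI.gain_insert_nonneg hkP hgain, fun j hj => ?_⟩, fun j hj l hl => ?_, fun β hβ => ?_⟩
  · refine le_trans ?_ (hI.gain_nonpos k hkP)
    exact sub_le_sub (mul_le_mul_of_nonneg_left (hon j hj) (sub_nonneg.2 hI.fee_mem.2)) (hoff j hj)
  · refine le_trans ?_ (hoff l hl)
    rcases Finset.mem_insert.1 hj with rfl | hj
    · simp [offPrice]
    · exact offPrice_insert_le hj hkP (hI.offPrice_le j hj k hkP)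
  · exact (hI.visits β hβ).tail ⟨k, hk.change_fee hI.fee_mem ⟨hβ.1, hβ.2.trans hI.fee_mem.2⟩,
      hgain.trans (gain_anti hβ.2), rfl⟩

theorem SweepReaches.sweepInvariant (hs : SweepReaches (homogeneousValue w) g α P) :
    SweepInvariant (homogeneousValue w) g α P := by
  induction hs with
  | start => exact .start
  | lower _ hα' hle hneg hI => exact hI.lower hα' hle hneg
  | add _ hstep hI =>
    obtain ⟨k, hk, hgain, rfl⟩ := hstep
    exact hI.add hk hgain

theorem SweepReaches.exists_lower_to_indifference (hs : SweepReaches (homogeneousValue w) g α P)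
    (hk : IsCandidate (homogeneousValue w) g α P k) :
    ∃ α' ∈ Set.Icc 0 α, SweepReaches (homogeneousValue w) g α' P ∧
      IsCandidate (homogeneousValue w) g α' P k ∧ gain (homogeneousValue w) g α' P k = 0 ∧
      ∀ β, α' < β → β ≤ α → gain (homogeneousValue w) g β P k < 0 := by
  have hI := hs.sweepInvariant
  obtain ⟨α', hα', hzero, hneg⟩ :=
    exists_gain_eq_zero_of_nonpos hI.fee_mem.1 (hI.gain_nonpos k hk.1)
  have hmem : ∀ β, α' ≤ β → β ≤ α → β ∈ Set.Icc (0 : ℝ) 1 := fun β hlt hle =>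
    ⟨hα'.1.trans hlt, hle.trans hI.fee_mem.2⟩
  refine ⟨α', hα', hs.lower hα'.1 hα'.2 fun β hlt hle j hj => ?_,
    hk.change_fee hI.fee_mem (hmem α' le_rfl hα'.2), hzero, hneg⟩
  exact ((hk.change_fee hI.fee_mem (hmem β hlt.le hle)).2.1 j hj).trans_lt (hneg β hlt hle)

theorem SweepReaches.exists_add_candidate (hs : SweepReaches (homogeneousValue w) g α P)
    (hP : ∃ k, k ∉ P) :
    ∃ α' ∈ Set.Icc 0 α, SweepReaches (homogeneousValue w) g α' P ∧
      ∃ k, IsCandidate (homogeneousValue w) g α' P k ∧ gain (homogeneousValue w) g α' P k = 0 ∧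
        SweepReaches (homogeneousValue w) g α' (insert k P) := by
  obtain ⟨k, hk⟩ := exists_isCandidate w g hs.sweepInvariant.fee_mem hP
  obtain ⟨α', hα', hs', hk', hzero, -⟩ := hs.exists_lower_to_indifference hk
  exact ⟨α', hα', hs', k, hk', hzero, hs'.add ⟨k, hk', hzero.ge, rfl⟩⟩

theorem exists_sweepReaches_card (w : Buyer → ℝ) (g : Buyer → Seller → Prop) {n : ℕ}
    (hn : n ≤ Nat.card Seller) :
    ∃ (α : ℝ) (P : Finset Seller), P.card = n ∧ SweepReaches (homogeneousValue w) g α P := by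
  induction n with
  | zero => exact ⟨1, ∅, rfl, .start⟩
  | succ n ih =>
    obtain ⟨α, P, hcard, hs⟩ := ih (Nat.le_of_succ_le hn)
    have hP : ∃ k, k ∉ P := by
      by_contra! hP
      have hall : Nat.card P = Nat.card Seller := Nat.card_congr (Equiv.subtypeUnivEquiv hP)
      rw [Nat.card_eq_fintype_card, Fintype.card_coe, hcard] at hall
      omega
    obtain ⟨α', -, -, k, hk, -, hs'⟩ := hs.exists_add_candidate hP
    exact ⟨α', insert k P, by rw [Finset.card_insert_of_notMem hk.1, hcard], hs'⟩

/-- Had the sweep to lower its fee below `α` before it adds the next seller of the run, that seller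
would have a negative gain at `α`. -/
theorem AlgVisits.exists_sweepReaches (hα : α ∈ Set.Icc (0 : ℝ) 1)
    (hv : AlgVisits (homogeneousValue w) g α P) :
    ∃ β, α ≤ β ∧ SweepReaches (homogeneousValue w) g β P := by
  induction hv with
  | refl => exact ⟨1, hα.2, .start⟩
  | tail _ hstep ih =>
    obtain ⟨β, hβ, hs⟩ := ih
    obtain ⟨k, hk, hgain, rfl⟩ := hstep
    obtain ⟨β', -, hs', hk', hzero, hneg⟩ :=
      hs.exists_lower_to_indifference (hk.change_fee hα hs.sweepInvariant.fee_mem)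
    refine ⟨β', ?_, hs'.add ⟨k, hk', hzero.ge, rfl⟩⟩
    by_contra! hlt
    exact hgain.not_gt (hneg α hlt hβ)

theorem AlgOutputs.gain_neg (hα : α ∈ Set.Icc (0 : ℝ) 1)
    (ho : AlgOutputs (homogeneousValue w) g α P) :
    ∀ j ∉ P, gain (homogeneousValue w) g α P j < 0 := by
  intro j hj
  obtain ⟨k, hk⟩ := exists_isCandidate w g hα ⟨j, hj⟩
  refine (hk.2.1 j hj).trans_lt ?_
  by_contra! hgain
  exact ho.2 ⟨_, k, hk, hgain, rfl⟩

theorem AlgOutputs.sweepReaches (hα : α ∈ Set.Icc (0 : ℝ) 1)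
    (ho : AlgOutputs (homogeneousValue w) g α P) : SweepReaches (homogeneousValue w) g α P := by
  obtain ⟨β, hβ, hs⟩ := ho.1.exists_sweepReaches hα
  exact hs.lower hα.1 hβ fun γ hlt _ j hj => (gain_anti hlt.le).trans_lt (ho.gain_neg hα j hj)

end Sweep

end PlatformMarket

open PlatformMarket in
theorem mainTheorem8_general {Buyer Seller : Type*} [Finite Buyer] [Fintype Seller]
    [DecidableEq Seller] (g : Buyer → Seller → Prop) (w : Buyer → ℝ) :
    (∀ P : Finset Seller,
      IsGreatest {p | IsCompetitivePrice (homogeneousValue w) (platformGraph g P) p}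
        (platformPrice (homogeneousValue w) g P)) ∧
    (∀ k ≤ Fintype.card Seller, ∃ α ∈ Set.Icc (0 : ℝ) 1, ∃ P : Finset Seller, P.card = k ∧
      IsPurePlatformEquilibrium (homogeneousValue w) g α P ∧
      SweepReaches (homogeneousValue w) g α P) ∧
    (∀ (α : ℝ) (P : Finset Seller), SweepReaches (homogeneousValue w) g α P →
      IsPurePlatformEquilibrium (homogeneousValue w) g α P ∧
      AlgVisits (homogeneousValue w) g α P ∧ ∀ j ∉ P, gain (homogeneousValue w) g α P j ≤ 0) ∧
    (∀ (α : ℝ) (P : Finset Seller), SweepReaches (homogeneousValue w) g α P → P ≠ Finset.univ →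
      ∃ α' ∈ Set.Icc (0 : ℝ) α, SweepReaches (homogeneousValue w) g α' P ∧
        ∃ j, IsCandidate (homogeneousValue w) g α' P j ∧ gain (homogeneousValue w) g α' P j = 0 ∧
          SweepReaches (homogeneousValue w) g α' (insert j P)) ∧
    ∀ α ∈ Set.Icc (0 : ℝ) 1, ∀ P : Finset Seller, AlgOutputs (homogeneousValue w) g α P →
      SweepReaches (homogeneousValue w) g α P := by
  refine ⟨fun P => isGreatest_maxPrice, fun k hk => ?_, fun α P hs => ?_,
    fun α P hs hP => hs.exists_add_candidate ?_, fun α hα P ho => ho.sweepReaches hα⟩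
  · obtain ⟨α, P, hcard, hs⟩ :=
      exists_sweepReaches_card w g (hk.trans_eq Nat.card_eq_fintype_card.symm)
    exact ⟨α, hs.sweepInvariant.fee_mem, P, hcard, hs.sweepInvariant.isEquilibrium, hs⟩
  · have hI := hs.sweepInvariant
    exact ⟨hI.isEquilibrium, hI.visits α ⟨hI.fee_mem.1, le_rfl⟩, hI.gain_nonpos⟩
  · simpa [Finset.eq_univ_iff_forall] using hP

theorem mainTheorem8 {Buyer Seller : Type*} [Fintype Buyer] [Fintype Seller] [DecidableEq Seller]
    (g : Buyer → Seller → Prop) (w : Buyer → ℝ) (hw : ∀ i, 0 ≤ w i)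
    (v : Buyer → Seller → ℝ) (hv : v = PlatformMarket.homogeneousValue w) :
    -- the maximum competitive prices exist, whichever sellers join
    (∀ P : Finset Seller,
      IsGreatest {p | PlatformMarket.IsCompetitivePrice v (PlatformMarket.platformGraph g P) p}
        (PlatformMarket.platformPrice v g P)) ∧
    -- equilibria of every size exist, and are found by the sweep
    (∀ k : ℕ, 1 ≤ k → k ≤ Fintype.card Seller →
      ∃ α ∈ Set.Icc (0 : ℝ) 1, ∃ P : Finset Seller, P.card = k ∧
        PlatformMarket.IsPurePlatformEquilibrium v g α P ∧
        PlatformMarket.SweepReaches v g α P) ∧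
    -- every set met by a sweep is an equilibrium at the current fee, and the algorithm at that
    -- fixed fee arrives at it, with no remaining seller having a positive gain
    (∀ (α : ℝ) (P : Finset Seller), PlatformMarket.SweepReaches v g α P →
      PlatformMarket.IsPurePlatformEquilibrium v g α P ∧
      PlatformMarket.AlgVisits v g α P ∧
      ∀ j ∉ P, PlatformMarket.gain v g α P j ≤ 0) ∧
    -- a sweep never gets stuck: the fee is lowered until a largest gain is zero, and then
    -- one seller is added
    (∀ (α : ℝ) (P : Finset Seller), PlatformMarket.SweepReaches v g α P → P ≠ Finset.univ →
      ∃ α' ∈ Set.Icc (0 : ℝ) α, PlatformMarket.SweepReaches v g α' P ∧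
        ∃ j, PlatformMarket.IsCandidate v g α' P j ∧ PlatformMarket.gain v g α' P j = 0 ∧
          PlatformMarket.SweepReaches v g α' (insert j P)) ∧
    -- every output of the algorithm at a fixed fee is met by a sweep
    (∀ α ∈ Set.Icc (0 : ℝ) 1, ∀ P : Finset Seller, PlatformMarket.AlgOutputs v g α P →
      PlatformMarket.SweepReaches v g α P) := by
  subst hv
  obtain ⟨hmax, hcard, hsweep⟩ := mainTheorem8_general g w
  exact ⟨hmax, fun k _ => hcard k, hsweep⟩
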